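/- Let $n,q\ge 1$, $k,r\ge 0$ be integers and $d=q^n$. Let $\mathsf G\subset U(q^2)$ be a finite non-empty (for example, universal) set of two-qudit gates. A circuit of size $m$ on $n$ qudits of local dimension $q$ is a product of $m$ unitaries, each of which applies an element of $\mathsf G$ to two neighboring qudits $i,i+1$ of a chain of $n$ qudits; $\mathsf G_r\subset U(d)$ denotes the set of circuits of size at most $r$. For $0\le\delta<1$, a pure state $|\psi\rangle\in\mathbb C^d$ has weak $\delta$-state complexity at most $r$, written $\mathcal C'_\delta(|\psi\rangle)\le r$, if there is $V\in\mathsf G_r$ with $$\tfrac12\big\|\,|\psi\rangle\langle\psi|-V|0\rangle\langle 0|V^\dagger\big\|_1\le\delta,$$ where $|0\rangle=|0\cdots0\rangle$ and $\|\cdot\|_1$ is the trace norm; otherwise $\mathcal C'_\delta(|\psi\rangle)>r$. For $\epsilon\ge0$, a finite ensemble $\{p_i,U_i\}$ of unitaries in $U(d)$ with probabilities $p_i$ is an $\epsilon$-approximate unitary $k$-design if $$\big\|\mathcal T^{(k)}_{\mathcal E}-\mathcal T^{(k)}_{U}\big\|_\diamond\le\frac{k!}{d^{2k}}\,\epsilon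 ,\qquad \mathcal T^{(k)}_{\mathcal E}(X)=\sum_i p_iU_i^{\otimes k}X(U_i^\dagger)^{\otimes k},\quad \mathcal T^{(k)}_{U}(X)=\int_{U(d)} U^{\otimes k}X(U^\dagger)^{\otimes k}\,dU,$$ with $dU$ the normalized Haar measure and $\|\Phi\|_\diamond=\max_{|v\rangle}\|(\Phi\otimes\mathrm{id})(|v\rangle\langle v|)\|_1$, the maximum being over pure states of the system and a memory of equal dimension. An $\epsilon$-approximate complex-projective $k$-design $\{p_i,|\psi_i\rangle\}_{i=1}^N$ is a weighted set of pure states that is the orbit $\{p_i,U_i|x\rangle\}$ of some unit vector $|x\rangle\in\mathbb C^d$ under an $\epsilon$-approximate unitary $k$-design (coinciding states may be merged, adding their probabilities). Theorem. Every $\epsilon$-approximate complex-projective $k$-design $\{p_i,|\psi_i\rangle\}_{i=1}^N$ in dimension $d=q^n$ contains at least $$\frac{d^k}{k!}\,\frac1{1+\epsilon}-\frac{n^r|\mathsf G|^r}{(1-\delta^2)^k}$$ distinct pure states $|\psi_i\rangle\langle\psi_i|$ of positive probability with weak $\delta$-state complexity $\mathcal C'_\delta(|\psi_i\rangle)>r$.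 -/

import Mathlib

open MeasureTheory
open scoped ENNReal Nat

noncomputable section

namespace DesignComplexity

variable {ι : Type} [Fintype ι] [DecidableEq ι]

/-! ### Pure states and the trace norm -/

/-- A state vector: a vector of Euclidean norm one in the Hilbert space with orthonormal basis
indexed by `ι`. -/
def IsState (v : ι → ℂ) : Prop := ∑ a, ‖v a‖ ^ 2 = 1

/-- The rank-one operator `|v⟩⟨v|`. -/
def ketbra (v : ι → ℂ) : Matrix ι ι ℂ := Matrix.vecMulVec v (star v)

/-- The trace norm `‖A‖₁`: the sum of the singular values of `A`, that is, of the square roots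
of the eigenvalues of `Aᴴ A`. -/
def traceNorm (A : Matrix ι ι ℂ) : ℝ :=
  ∑ a, Real.sqrt ((Matrix.isHermitian_conjTranspose_mul_self A).eigenvalues a)

/-! ### The diamond norm -/

/-- `(Φ ⊗ id)(X)`, where `Φ` acts on the first tensor factor and the second factor, the memory,
has the same dimension. -/
def withMemory (Φ : Matrix ι ι ℂ →ₗ[ℂ] Matrix ι ι ℂ) (X : Matrix (ι × ι) (ι × ι) ℂ) :
    Matrix (ι × ι) (ι × ι) ℂ :=
  Matrix.of fun a b => Φ (Matrix.of fun s t => X (s, a.2) (t, b.2)) a.1 b.1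

/-- The diamond norm of a difference `Φ` of two quantum channels: the maximum over all pure input
states `|v⟩` of system and memory of `‖(Φ ⊗ id)(|v⟩⟨v|)‖₁`. -/
def diamondNorm (Φ : Matrix ι ι ℂ →ₗ[ℂ] Matrix ι ι ℂ) : ℝ≥0∞ :=
  ⨆ (v : ι × ι → ℂ) (_ : IsState v), ENNReal.ofReal (traceNorm (withMemory Φ (ketbra v)))

/-! ### Haar measure on the unitary group -/

instance compactSpace_unitaryGroup : CompactSpace (Matrix.unitaryGroup ι ℂ) := by
  have hsub : ((Matrix.unitaryGroup ι ℂ : Submonoid (Matrix ι ι ℂ)) : Set (Matrix ι ι ℂ)) ⊆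
      Set.pi Set.univ fun _ : ι => Set.pi Set.univ fun _ : ι => Metric.closedBall (0 : ℂ) 1 := by
    intro U hU i _ j _
    simpa using entry_norm_bound_of_unitary hU i j
  have hcomp : IsCompact (Set.pi Set.univ fun _ : ι => Set.pi Set.univ fun _ : ι =>
      Metric.closedBall (0 : ℂ) 1) :=
    isCompact_univ_pi fun _ => isCompact_univ_pi fun _ => isCompact_closedBall 0 1
  exact isCompact_iff_compactSpace.1
    (hcomp.of_isClosed_subset (isClosed_unitary (R := Matrix ι ι ℂ)) hsub)

instance measurableSpace_unitaryGroup : MeasurableSpace (Matrix.unitaryGroup ι ℂ) := borel _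

instance borelSpace_unitaryGroup : BorelSpace (Matrix.unitaryGroup ι ℂ) := ⟨rfl⟩

/-- The normalized Haar measure on the unitary group. -/
def haarUnitary (ι : Type) [Fintype ι] [DecidableEq ι] : Measure (Matrix.unitaryGroup ι ℂ) :=
  Measure.haarMeasure ⊤

instance isFiniteMeasure_haarUnitary : IsFiniteMeasure (haarUnitary ι) := by
  unfold haarUnitary; infer_instance

/-! ### Twirls and approximate unitary designs -/

/-- The `k`-fold tensor power `A^{⊗ k}`. -/
def tensorPow (k : ℕ) (A : Matrix ι ι ℂ) : Matrix (Fin k → ι) (Fin k → ι) ℂ :=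
  Matrix.of fun s t => ∏ l, A (s l) (t l)

/-- The map `X ↦ U^{⊗ k} X (U^{⊗ k})ᴴ`. -/
def conjPow (k : ℕ) (U : Matrix ι ι ℂ) :
    Matrix (Fin k → ι) (Fin k → ι) ℂ →ₗ[ℂ] Matrix (Fin k → ι) (Fin k → ι) ℂ where
  toFun X := tensorPow k U * X * (tensorPow k U).conjTranspose
  map_add' X Y := by rw [mul_add, add_mul]
  map_smul' c X := by simp

theorem integrable_conjPow (k : ℕ) (X : Matrix (Fin k → ι) (Fin k → ι) ℂ) (s t : Fin k → ι) :
    Integrable (fun U : Matrix.unitaryGroup ι ℂ => conjPow k (U : Matrix ι ι ℂ) X s t)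
      (haarUnitary ι) := by
  have hc : Continuous fun U : Matrix.unitaryGroup ι ℂ => conjPow k (U : Matrix ι ι ℂ) X s t := by
    have hentry : ∀ i j, Continuous fun U : Matrix.unitaryGroup ι ℂ => (U : Matrix ι ι ℂ) i j :=
      fun i j => (continuous_subtype_val.matrix_elem i j)
    simp only [conjPow, tensorPow, LinearMap.coe_mk, AddHom.coe_mk, Matrix.mul_apply,
      Matrix.conjTranspose_apply, Matrix.of_apply]
    refine continuous_finsetSum _ fun j _ => Continuous.mul ?_ ?_
    · exact continuous_finsetSum _ fun l _ =>
        (continuous_finsetProd _ fun m _ => hentry _ _).mul continuous_const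
    · exact (continuous_finsetProd _ fun m _ => hentry _ _).star
  exact hc.integrable_of_hasCompactSupport (HasCompactSupport.of_compactSpace _)

/-- The `k`-fold twirl `X ↦ ∫ U^{⊗ k} X (U^{⊗ k})ᴴ dU` over the Haar measure (entrywise
integral). -/
def haarTwirl (ι : Type) [Fintype ι] [DecidableEq ι] (k : ℕ) :
    Matrix (Fin k → ι) (Fin k → ι) ℂ →ₗ[ℂ] Matrix (Fin k → ι) (Fin k → ι) ℂ where
  toFun X := Matrix.of fun s t =>
    ∫ U : Matrix.unitaryGroup ι ℂ, conjPow k (U : Matrix ι ι ℂ) X s t ∂(haarUnitary ι)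
  map_add' X Y := by
    ext s t
    simp only [map_add, Matrix.add_apply, Matrix.of_apply]
    exact integral_add (integrable_conjPow k X s t) (integrable_conjPow k Y s t)
  map_smul' c X := by
    ext s t
    simp only [map_smul, Matrix.smul_apply, Matrix.of_apply, RingHom.id_apply]
    exact integral_smul c _

/-- A finite ensemble `{p_i, U_i}` of unitaries. -/
structure UnitaryEnsemble (ι : Type) [Fintype ι] [DecidableEq ι] where
  /-- the number of elements -/
  N : ℕ
  /-- the probabilities -/
  p : Fin N → ℝ
  /-- the unitaries -/
  U : Fin N → Matrix.unitaryGroup ι ℂ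
  p_nonneg : ∀ i, 0 ≤ p i
  p_sum : ∑ i, p i = 1

/-- The `k`-fold twirl `X ↦ ∑ i, p_i U_i^{⊗ k} X (U_i^{⊗ k})ᴴ` over an ensemble. -/
def UnitaryEnsemble.twirl (E : UnitaryEnsemble ι) (k : ℕ) :
    Matrix (Fin k → ι) (Fin k → ι) ℂ →ₗ[ℂ] Matrix (Fin k → ι) (Fin k → ι) ℂ :=
  ∑ i, (E.p i : ℂ) • conjPow k (E.U i : Matrix ι ι ℂ)

/-- `E` is an `ε`-approximate unitary `k`-design: in dimension `d`, its `k`-fold twirl is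
`(k! / d^{2k}) ε`-close to the Haar twirl in diamond norm. -/
def UnitaryEnsemble.IsApproxDesign (E : UnitaryEnsemble ι) (k : ℕ) (ε : ℝ) : Prop :=
  diamondNorm (E.twirl k - haarTwirl ι k) ≤
    ENNReal.ofReal ((k ! : ℝ) / (Fintype.card ι : ℝ) ^ (2 * k) * ε)

/-! ### Approximate complex-projective designs -/

/-- A finite ensemble `{p_i, |ψ_i⟩}` of pure states. -/
structure StateEnsemble (ι : Type) [Fintype ι] [DecidableEq ι] where
  /-- the number of elements -/
  N : ℕ
  /-- the probabilities -/
  p : Fin N → ℝ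
  /-- the state vectors -/
  ψ : Fin N → ι → ℂ
  p_nonneg : ∀ i, 0 ≤ p i
  p_sum : ∑ i, p i = 1
  isState : ∀ i, IsState (ψ i)

open Classical in
/-- The total probability with which the pure state `ρ = |ψ⟩⟨ψ|` occurs in the ensemble. -/
def StateEnsemble.prob (S : StateEnsemble ι) (ρ : Matrix ι ι ℂ) : ℝ :=
  ∑ i, if ketbra (S.ψ i) = ρ then S.p i else 0

theorem isState_iff {κ : Type} [Fintype κ] (v : κ → ℂ) : IsState v ↔ star v ⬝ᵥ v = 1 := by
  have h : star v ⬝ᵥ v = ((∑ a, ‖v a‖ ^ 2 : ℝ) : ℂ) := by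
    simp only [dotProduct, Pi.star_apply, RCLike.star_def, RCLike.conj_mul]
    push_cast
    rfl
  rw [h, IsState]
  norm_cast

theorem isState_mulVec (U : Matrix.unitaryGroup ι ℂ) {x : ι → ℂ} (hx : IsState x) :
    IsState ((U : Matrix ι ι ℂ).mulVec x) := by
  rw [isState_iff] at hx ⊢
  have hU : (U : Matrix ι ι ℂ).conjTranspose * (U : Matrix ι ι ℂ) = 1 :=
    Matrix.mem_unitaryGroup_iff'.1 U.2
  rw [Matrix.star_mulVec, Matrix.dotProduct_mulVec, Matrix.vecMul_vecMul, hU, Matrix.vecMul_one,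
    hx]

/-- The orbit `{p_i, U_i |x⟩}` of a unitary ensemble `{p_i, U_i}`. -/
def UnitaryEnsemble.orbit (E : UnitaryEnsemble ι) (x : ι → ℂ) (hx : IsState x) :
    StateEnsemble ι where
  N := E.N
  p := E.p
  ψ i := (E.U i : Matrix ι ι ℂ).mulVec x
  p_nonneg := E.p_nonneg
  p_sum := E.p_sum
  isState i := isState_mulVec (E.U i) hx

/-- `S` is an `ε`-approximate complex-projective `k`-design: it is, as a weighted set of pure
states, the orbit of a starting state under an `ε`-approximate unitary `k`-design. Coinciding
states may be listed separately or merged, with their probabilities added. -/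
def StateEnsemble.IsApproxProjectiveDesign (S : StateEnsemble ι) (k : ℕ) (ε : ℝ) : Prop :=
  ∃ (E : UnitaryEnsemble ι) (x : ι → ℂ) (hx : IsState x),
    E.IsApproxDesign k ε ∧ ∀ ρ, S.prob ρ = (E.orbit x hx).prob ρ

/-! ### Circuits and weak state complexity

The basis of the space of `n` qudits of local dimension `q` is indexed by the strings
`Fin n → Fin q`. -/

/-- The two-qudit operator `g` applied to the qudits `i` and `j` (in this order) of an `n`-qudit
system, tensored with the identity on all the others. -/
def applyGate {n q : ℕ} (g : Matrix (Fin q × Fin q) (Fin q × Fin q) ℂ) (i j : Fin n) :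
    Matrix (Fin n → Fin q) (Fin n → Fin q) ℂ :=
  Matrix.of fun s t => if ∀ l, l ≠ i → l ≠ j → s l = t l then g (s i, s j) (t i, t j) else 0

/-- `IsCircuit n G m V`: the operator `V` on `n` qudits is the product of `m` gates, each of
which is an element of the gate set `G` applied to a pair of neighboring qudits `i`, `i + 1`. -/
inductive IsCircuit {q : ℕ} (n : ℕ) (G : Finset (Matrix.unitaryGroup (Fin q × Fin q) ℂ)) :
    ℕ → Matrix (Fin n → Fin q) (Fin n → Fin q) ℂ → Prop
  | nil : IsCircuit n G 0 1
  | cons {m : ℕ} {V : Matrix (Fin n → Fin q) (Fin n → Fin q) ℂ}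
      (g : Matrix.unitaryGroup (Fin q × Fin q) ℂ) (i j : Fin n) (hg : g ∈ G)
      (hij : (i : ℕ) + 1 = (j : ℕ)) (hV : IsCircuit n G m V) :
      IsCircuit n G (m + 1) (applyGate (g : Matrix (Fin q × Fin q) (Fin q × Fin q) ℂ) i j * V)

/-- The set of circuits of size at most `r`. -/
def circuits {q : ℕ} (n : ℕ) (G : Finset (Matrix.unitaryGroup (Fin q × Fin q) ℂ)) (r : ℕ) :
    Set (Matrix (Fin n → Fin q) (Fin n → Fin q) ℂ) :=
  {V | ∃ m ≤ r, IsCircuit n G m V}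

/-- The computational basis state `|0⟩ = |0…0⟩`. -/
def zeroKet (n q : ℕ) : (Fin n → Fin q) → ℂ := fun s => if ∀ l, (s l : ℕ) = 0 then 1 else 0

/-- The state `|ψ⟩` has weak `δ`-state complexity at most `r`: some circuit `V` of size at most
`r` satisfies `½ ‖|ψ⟩⟨ψ| - V |0⟩⟨0| Vᴴ‖₁ ≤ δ`. -/
def WeakComplexityLE {n q : ℕ} (G : Finset (Matrix.unitaryGroup (Fin q × Fin q) ℂ)) (δ : ℝ)
    (r : ℕ) (ψ : (Fin n → Fin q) → ℂ) : Prop :=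
  ∃ V ∈ circuits n G r,
    1 / 2 * traceNorm (ketbra ψ - V * ketbra (zeroKet n q) * V.conjTranspose) ≤ δ

end DesignComplexity

end

noncomputable section

namespace DesignComplexity

set_option linter.unusedSectionVars false

variable {ι : Type} [Fintype ι] [DecidableEq ι]

/-! For every state `v` the design satisfies `∑ p_i |⟨v|ψ_i⟩|^{2k} ≤ W` with `W = k!/d^k · (1 + ε)`.
By Markov's inequality, the members with `|⟨v|ψ_i⟩|² ≥ b` then have total probability at most `W /
b^k`. With `b = 1`, a single pure state carries weight at most `W`. With `b = 1 - δ²` and `v =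
V|0⟩`, the members within trace distance `δ` of the output of one circuit `V` carry at most `W / (1
- δ²)^k` (`one_sub_sq_le_overlap`). At most `n^r |G|^r` circuits have size at most `r`
(`exists_finset_circuits_subset`), and the total probability is one, so the remaining weight must be
spread over many complex states.

The moment bound is the expectation of the twirled state `|x⟩⟨x|^{⊗k}` in `|v⟩^{⊗k}`: the diamond
norm controls the deviation from the Haar value, which is at most `k!/d^k`
(`card_pow_mul_haarMoment_le`). For that value no representation theory is needed. Invariance makes
the Haar moment independent of the state `v`, so `v` may be averaged over normalized vectors of
random phases. For each fixed `U` the phase average is estimated by expanding the power: only pairs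
of index tuples that are permutations of each other survive, at most `k!` for each tuple
(`sum_norm_phaseVec_dotProduct_pow_le`). -/

/-! ### Moments of random phases -/

/-- The vector of phases `exp (2πi θ a / N)`. -/
def phaseVec {N : ℕ} [NeZero N] (θ : ι → ZMod N) : ι → ℂ := fun a => ZMod.stdAddChar (θ a)

theorem norm_phaseVec {N : ℕ} [NeZero N] (θ : ι → ZMod N) (a : ι) : ‖phaseVec θ a‖ = 1 :=
  AddChar.norm_apply _ _

/-- Two tuples whose fibers all have the same size differ by a permutation of the indices. -/
theorem exists_perm_of_card_fiber_eq {κ : Type} [Fintype κ] [DecidableEq κ] (s t : κ → ι)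
    (h : ∀ a, Fintype.card {l // s l = a} = Fintype.card {l // t l = a}) :
    ∃ σ : Equiv.Perm κ, t = s ∘ σ := by
  classical
  let e : ∀ a, {l // t l = a} ≃ {l // s l = a} := fun a => Fintype.equivOfCardEq (h a).symm
  refine ⟨(Equiv.sigmaFiberEquiv t).symm.trans ((Equiv.sigmaCongrRight fun a =>
    (e a)).trans (Equiv.sigmaFiberEquiv s)), ?_⟩
  funext l
  simp only [Function.comp, Equiv.trans_apply]
  exact ((e (t l) ⟨l, rfl⟩).2).symm

/-- Some index `a` occurs a different number of times in `s` and in `t`. Shifting the phase at `a`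
by one step permutes the summands' index set and multiplies the sum by a root of unity other than 1.
-/
theorem sum_phaseVec_eq_zero {k : ℕ} (s t : Fin k → ι)
    (h : ¬ ∃ σ : Equiv.Perm (Fin k), t = s ∘ σ) :
    ∑ θ : ι → ZMod (k + 1),
      (∏ l, star (phaseVec θ (s l))) * ∏ l, phaseVec θ (t l) = 0 := by
  classical
  obtain ⟨a, ha⟩ : ∃ a, Fintype.card {l // s l = a} ≠ Fintype.card {l // t l = a} := by
    by_contra! hc
    exact h (exists_perm_of_card_fiber_eq s t hc)
  have hshift : ∀ (u : Fin k → ι) (θ : ι → ZMod (k + 1)),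
      ∏ l, phaseVec (θ + Pi.single a 1) (u l) =
        ZMod.stdAddChar ((Fintype.card {l // u l = a} : ℕ) : ZMod (k + 1)) *
          ∏ l, phaseVec θ (u l) := by
    intro u θ
    have h1 : ∀ l, phaseVec (θ + Pi.single a 1) (u l) =
        (if u l = a then ZMod.stdAddChar (1 : ZMod (k + 1)) else 1) * phaseVec θ (u l) := by
      intro l
      simp only [phaseVec, Pi.add_apply, AddChar.map_add_eq_mul, Pi.single_apply]
      rw [mul_comm]
      split_ifs <;> simp
    simp_rw [h1]
    rw [Finset.prod_mul_distrib, Finset.prod_ite, Finset.prod_const, Finset.prod_const_one, mul_one,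
      Fintype.card_subtype, ← AddChar.map_nsmul_eq_pow, nsmul_eq_mul, mul_one]
  set cs := Fintype.card {l // s l = a}
  set ct := Fintype.card {l // t l = a}
  have hcs : cs ≤ k := (Fintype.card_subtype_le _).trans_eq (Fintype.card_fin k)
  have hct : ct ≤ k := (Fintype.card_subtype_le _).trans_eq (Fintype.card_fin k)
  set z : ℂ := star (ZMod.stdAddChar (cs : ZMod (k + 1))) * ZMod.stdAddChar (ct : ZMod (k + 1))
    with hz
  -- Both multiplicities lie between `0` and `k`, so they stay distinct modulo `k + 1`; this is why
  -- phases of order `k + 1` suffice.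
  have hz1 : z ≠ 1 := by
    intro hz1
    rw [hz, RCLike.star_def, ← AddChar.map_neg_eq_conj, ← AddChar.map_add_eq_mul,
      ← AddChar.map_zero_eq_one (ZMod.stdAddChar (N := k + 1))] at hz1
    have h2 := ZMod.injective_stdAddChar hz1
    rw [neg_add_eq_zero, ZMod.natCast_eq_natCast_iff', Nat.mod_eq_of_lt (by omega),
      Nat.mod_eq_of_lt (by omega)] at h2
    exact ha h2
  set A := ∑ θ : ι → ZMod (k + 1),
      (∏ l, star (phaseVec θ (s l))) * ∏ l, phaseVec θ (t l) with hA
  have key : A = z * A := by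
    conv_lhs => rw [hA, ← Equiv.sum_comp (Equiv.addRight (Pi.single a (1 : ZMod (k + 1))))]
    rw [hA, Finset.mul_sum]
    refine Finset.sum_congr rfl fun θ _ => ?_
    simp only [Equiv.coe_addRight]
    rw [← star_prod, ← star_prod, hshift, hshift, star_mul', hz]
    ring
  have : (1 - z) * A = 0 := by rw [sub_mul, one_mul, ← key, sub_self]
  exact (mul_eq_zero.1 this).resolve_left (sub_ne_zero.2 hz1.symm)

theorem sum_norm_phaseVec_dotProduct_pow_le (k : ℕ) (y : ι → ℂ) :
    ∑ θ : ι → ZMod (k + 1), ‖star (phaseVec θ) ⬝ᵥ y‖ ^ (2 * k) ≤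
      (Fintype.card (ι → ZMod (k + 1)) : ℝ) * (k ! : ℝ) * (∑ a, ‖y a‖ ^ 2) ^ k := by
  classical
  set M : ℝ := (Fintype.card (ι → ZMod (k + 1)) : ℝ) with hM
  have hexp : ∀ θ : ι → ZMod (k + 1), ((‖star (phaseVec θ) ⬝ᵥ y‖ ^ (2 * k) : ℝ) : ℂ) =
      ∑ s : Fin k → ι, ∑ t : Fin k → ι, ((∏ l, y (s l)) * ∏ l, star (y (t l))) *
        ((∏ l, star (phaseVec θ (s l))) * ∏ l, phaseVec θ (t l)) := by
    intro θ
    have h1 : (star (phaseVec θ) ⬝ᵥ y) ^ k =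
        ∑ s : Fin k → ι, ∏ l, (star (phaseVec θ (s l)) * y (s l)) := by
      simp only [dotProduct, Pi.star_apply, Fintype.sum_pow]
    have h2 : ((‖star (phaseVec θ) ⬝ᵥ y‖ ^ (2 * k) : ℝ) : ℂ) =
        (star (phaseVec θ) ⬝ᵥ y) ^ k * star ((star (phaseVec θ) ⬝ᵥ y) ^ k) := by
      rw [RCLike.star_def, RCLike.mul_conj, norm_pow, mul_comm 2 k, pow_mul, Complex.ofReal_pow]
      rfl
    rw [h2, h1, star_sum, Finset.sum_mul_sum]
    refine Finset.sum_congr rfl fun s _ => Finset.sum_congr rfl fun t _ => ?_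
    rw [star_prod]
    simp only [star_mul', star_star, Finset.prod_mul_distrib]
    ring
  have hterm : ∀ s t : Fin k → ι,
      ‖∑ θ : ι → ZMod (k + 1), ((∏ l, y (s l)) * ∏ l, star (y (t l))) *
        ((∏ l, star (phaseVec θ (s l))) * ∏ l, phaseVec θ (t l))‖ ≤
      if ∃ σ : Equiv.Perm (Fin k), t = s ∘ σ then M * ∏ l, ‖y (s l)‖ ^ 2 else 0 := by
    intro s t
    rw [← Finset.mul_sum]
    split_ifs with h
    · obtain ⟨σ, rfl⟩ := h
      rw [norm_mul, mul_comm]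
      refine mul_le_mul ?_ (le_of_eq ?_) (norm_nonneg _) (Nat.cast_nonneg _)
      · refine (norm_sum_le _ _).trans_eq ?_
        simp [norm_phaseVec, norm_prod, hM]
      · simp only [norm_mul, norm_prod, norm_star, Function.comp]
        rw [Equiv.prod_comp σ (fun l => ‖y (s l)‖), ← Finset.prod_mul_distrib]
        simp only [sq]
    · rw [sum_phaseVec_eq_zero s t h, mul_zero, norm_zero]
  -- Only an upper bound: when `s` has repeated entries, different permutations give the same `t`.
  have hcount : ∀ s : Fin k → ι,
      ((Finset.univ.filter fun t : Fin k → ι =>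
        ∃ σ : Equiv.Perm (Fin k), t = s ∘ σ).card : ℝ) ≤ (k ! : ℝ) := by
    intro s
    have hsub : (Finset.univ.filter fun t : Fin k → ι =>
        ∃ σ : Equiv.Perm (Fin k), t = s ∘ σ) ⊆
        Finset.univ.image fun σ : Equiv.Perm (Fin k) => s ∘ σ := by
      intro t ht
      obtain ⟨σ, rfl⟩ := (Finset.mem_filter.1 ht).2
      exact Finset.mem_image_of_mem _ (Finset.mem_univ _)
    have := (Finset.card_le_card hsub).trans Finset.card_image_le
    rw [Finset.card_univ, Fintype.card_perm, Fintype.card_fin] at this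
    exact_mod_cast this
  have hnonneg : 0 ≤ ∑ θ : ι → ZMod (k + 1), ‖star (phaseVec θ) ⬝ᵥ y‖ ^ (2 * k) :=
    Finset.sum_nonneg fun _ _ => by positivity
  calc ∑ θ : ι → ZMod (k + 1), ‖star (phaseVec θ) ⬝ᵥ y‖ ^ (2 * k)
      = ‖((∑ θ : ι → ZMod (k + 1), ‖star (phaseVec θ) ⬝ᵥ y‖ ^ (2 * k) : ℝ) : ℂ)‖ := by
        rw [Complex.norm_real, Real.norm_of_nonneg hnonneg]
    _ = ‖∑ s : Fin k → ι, ∑ t : Fin k → ι, ∑ θ : ι → ZMod (k + 1),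
          ((∏ l, y (s l)) * ∏ l, star (y (t l))) *
            ((∏ l, star (phaseVec θ (s l))) * ∏ l, phaseVec θ (t l))‖ := by
        rw [Complex.ofReal_sum]
        simp_rw [hexp]
        rw [Finset.sum_comm]
        congr 1
        exact Finset.sum_congr rfl fun s _ => Finset.sum_comm
    _ ≤ ∑ s : Fin k → ι, ∑ t : Fin k → ι,
          if ∃ σ : Equiv.Perm (Fin k), t = s ∘ σ then M * ∏ l, ‖y (s l)‖ ^ 2 else 0 :=
        (norm_sum_le _ _).trans (Finset.sum_le_sum fun s _ => (norm_sum_le _ _).trans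
          (Finset.sum_le_sum fun t _ => hterm s t))
    _ ≤ ∑ s : Fin k → ι, (k ! : ℝ) * (M * ∏ l, ‖y (s l)‖ ^ 2) := by
        refine Finset.sum_le_sum fun s _ => ?_
        rw [← Finset.sum_filter, Finset.sum_const, nsmul_eq_mul]
        exact mul_le_mul_of_nonneg_right (hcount s) (by positivity)
    _ = M * (k ! : ℝ) * (∑ a, ‖y a‖ ^ 2) ^ k := by
        rw [Fintype.sum_pow, Finset.mul_sum]
        exact Finset.sum_congr rfl fun s _ => by ring

/-! ### Moments of Haar random states -/

/-- Extend `u` to an orthonormal basis and take the change-of-basis matrix. This yields transitivity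
of the unitary group on states. -/
theorem exists_unitary_mulVec_single (i₀ : ι) {u : ι → ℂ} (hu : IsState u) :
    ∃ W : Matrix.unitaryGroup ι ℂ, (W : Matrix ι ι ℂ).mulVec (Pi.single i₀ 1) = u := by
  classical
  have hnorm : ‖(WithLp.toLp 2 u : EuclideanSpace ℂ ι)‖ = 1 := by
    rw [EuclideanSpace.norm_eq, Real.sqrt_eq_one]
    exact hu
  obtain ⟨b, hb⟩ := Orthonormal.exists_orthonormalBasis_extension_of_card_eq (𝕜 := ℂ)
    (E := EuclideanSpace ℂ ι) (ι := ι) finrank_euclideanSpace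
    (v := fun _ => WithLp.toLp 2 u) (s := {i₀}) (by
      refine ⟨fun _ => hnorm, fun i j hij => (hij (Subsingleton.elim i j)).elim⟩)
  refine ⟨⟨_, OrthonormalBasis.toMatrix_orthonormalBasis_mem_unitary
    (EuclideanSpace.basisFun ι ℂ) b⟩, ?_⟩
  funext a
  simp [Module.Basis.toMatrix_apply, hb i₀ rfl]

/-- The Haar average of `|⟨v|U|x⟩|^{2k}`. -/
def haarMoment (k : ℕ) (x v : ι → ℂ) : ℝ :=
  ∫ U : Matrix.unitaryGroup ι ℂ, ‖star v ⬝ᵥ (U : Matrix ι ι ℂ).mulVec x‖ ^ (2 * k)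
    ∂(haarUnitary ι)

theorem haarUnitary_univ : haarUnitary ι Set.univ = 1 := by
  have := Measure.haarMeasure_self (G := Matrix.unitaryGroup ι ℂ) (K₀ := ⊤)
  simpa [haarUnitary] using this

/-- Left invariance of Haar measure: `W` is moved from the bra onto `U` as `W⁻¹ U`. -/
theorem haarMoment_mulVec (k : ℕ) (x v : ι → ℂ) (W : Matrix.unitaryGroup ι ℂ) :
    haarMoment k x ((W : Matrix ι ι ℂ).mulVec v) = haarMoment k x v := by
  have : (haarUnitary ι).IsMulLeftInvariant := by unfold haarUnitary; infer_instance
  unfold haarMoment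
  rw [← integral_mul_left_eq_self (μ := haarUnitary ι)
    (fun U => ‖star v ⬝ᵥ (U : Matrix ι ι ℂ).mulVec x‖ ^ (2 * k)) W⁻¹]
  refine integral_congr_ae (Filter.Eventually.of_forall fun U => ?_)
  have h : ((W⁻¹ * U : Matrix.unitaryGroup ι ℂ) : Matrix ι ι ℂ) =
      (W : Matrix ι ι ℂ).conjTranspose * (U : Matrix ι ι ℂ) := rfl
  simp only [h]
  rw [← Matrix.mulVec_mulVec, Matrix.star_mulVec, ← Matrix.dotProduct_mulVec]

theorem haarMoment_eq (k : ℕ) (x : ι → ℂ) {v v' : ι → ℂ} (hv : IsState v) (hv' : IsState v') :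
    haarMoment k x v = haarMoment k x v' := by
  obtain ⟨i₀⟩ : Nonempty ι := by
    by_contra h
    rw [not_nonempty_iff] at h
    simp [IsState] at hv
  obtain ⟨W, rfl⟩ := exists_unitary_mulVec_single i₀ hv
  obtain ⟨W', rfl⟩ := exists_unitary_mulVec_single i₀ hv'
  rw [haarMoment_mulVec, haarMoment_mulVec]

theorem integrable_moment (k : ℕ) (x v : ι → ℂ) :
    Integrable (fun U : Matrix.unitaryGroup ι ℂ =>
      ‖star v ⬝ᵥ (U : Matrix ι ι ℂ).mulVec x‖ ^ (2 * k)) (haarUnitary ι) := by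
  have hc : Continuous fun U : Matrix.unitaryGroup ι ℂ =>
      ‖star v ⬝ᵥ (U : Matrix ι ι ℂ).mulVec x‖ ^ (2 * k) :=
    ((continuous_const.dotProduct
      (continuous_subtype_val.matrix_mulVec continuous_const)).norm).pow _
  exact hc.integrable_of_hasCompactSupport (HasCompactSupport.of_compactSpace _)

theorem haarMoment_smul (k : ℕ) (x v : ι → ℂ) (c : ℂ) :
    haarMoment k x (c • v) = ‖c‖ ^ (2 * k) * haarMoment k x v := by
  unfold haarMoment
  rw [← integral_const_mul]
  simp [star_smul, smul_dotProduct, mul_pow]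

theorem card_pow_mul_haarMoment_le (k : ℕ) {x v : ι → ℂ} (hx : IsState x) (hv : IsState v) :
    (Fintype.card ι : ℝ) ^ k * haarMoment k x v ≤ (k ! : ℝ) := by
  have hne : Nonempty ι := by
    by_contra h
    rw [not_nonempty_iff] at h
    simp [IsState] at hv
  set d : ℝ := (Fintype.card ι : ℝ) with hd
  have hd0 : 0 < d := by rw [hd]; exact_mod_cast Fintype.card_pos
  set M : ℝ := (Fintype.card (ι → ZMod (k + 1)) : ℝ) with hM
  have hM0 : 0 < M := by rw [hM]; exact_mod_cast Fintype.card_pos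
  -- A phase vector has norm `√d`, and the moment is homogeneous of degree `2k` in `v`; this
  -- produces the factor `d ^ k`.
  have hphase : ∀ θ : ι → ZMod (k + 1),
      haarMoment k x (phaseVec θ) = d ^ k * haarMoment k x v := by
    intro θ
    have hs : IsState (((Real.sqrt d)⁻¹ : ℂ) • phaseVec θ) := by
      simp [IsState, norm_phaseVec, ← hd, hd0.le, hd0.ne']
    rw [haarMoment_eq k x hv hs, haarMoment_smul, ← mul_assoc, pow_mul, norm_inv,
      Complex.norm_real, Real.norm_of_nonneg (Real.sqrt_nonneg _), inv_pow, Real.sq_sqrt hd0.le,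
      inv_pow, mul_inv_cancel₀ (pow_ne_zero _ hd0.ne'), one_mul]
  have hsum : M * (d ^ k * haarMoment k x v) ≤ M * (k ! : ℝ) := by
    calc M * (d ^ k * haarMoment k x v)
        = ∑ θ : ι → ZMod (k + 1), haarMoment k x (phaseVec θ) := by
          simp_rw [hphase]
          rw [Finset.sum_const, Finset.card_univ, nsmul_eq_mul]
      _ = ∫ U : Matrix.unitaryGroup ι ℂ, ∑ θ : ι → ZMod (k + 1),
            ‖star (phaseVec θ) ⬝ᵥ (U : Matrix ι ι ℂ).mulVec x‖ ^ (2 * k) ∂(haarUnitary ι) := by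
          rw [integral_finsetSum _ fun θ _ => integrable_moment k x _]
          rfl
      _ ≤ ∫ U : Matrix.unitaryGroup ι ℂ, M * (k ! : ℝ) ∂(haarUnitary ι) := by
          refine integral_mono (integrable_finsetSum _ fun θ _ => integrable_moment k x _)
            (integrable_const _) fun U => ?_
          refine (sum_norm_phaseVec_dotProduct_pow_le k _).trans_eq ?_
          rw [show ∑ a, ‖(U : Matrix ι ι ℂ).mulVec x a‖ ^ 2 = 1 from isState_mulVec U hx, one_pow,
            mul_one]
      _ = M * (k ! : ℝ) := by
          rw [integral_const, measureReal_def, haarUnitary_univ]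
          simp
  exact le_of_mul_le_mul_left hsum hM0

/-! ### Rank-one operators and the trace norm -/

theorem mul_ketbra_mul_conjTranspose (A : Matrix ι ι ℂ) (v : ι → ℂ) :
    A * ketbra v * A.conjTranspose = ketbra (A.mulVec v) := by
  rw [ketbra, ketbra, Matrix.mul_vecMulVec, Matrix.vecMulVec_mul, Matrix.star_mulVec]

theorem ketbra_mulVec (v w : ι → ℂ) : (ketbra v).mulVec w = (star v ⬝ᵥ w) • v := by
  rw [ketbra, Matrix.vecMulVec_mulVec]
  ext a
  simp [mul_comm]

theorem star_dotProduct_mul_self (v w : ι → ℂ) :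
    (star v ⬝ᵥ w) * (star w ⬝ᵥ v) = ((‖star w ⬝ᵥ v‖ ^ 2 : ℝ) : ℂ) := by
  have h : star v ⬝ᵥ w = star (star w ⬝ᵥ v) := Matrix.star_dotProduct v w
  rw [h, RCLike.star_def, RCLike.conj_mul, Complex.ofReal_pow]
  rfl

theorem star_dotProduct_ketbra_mulVec (v w : ι → ℂ) :
    star w ⬝ᵥ (ketbra v).mulVec w = ((‖star w ⬝ᵥ v‖ ^ 2 : ℝ) : ℂ) := by
  rw [ketbra_mulVec, dotProduct_smul, smul_eq_mul, star_dotProduct_mul_self]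

open scoped ComplexOrder in
theorem conjTranspose_mul_self_eigenvalues_nonneg (A : Matrix ι ι ℂ) (a : ι) :
    0 ≤ (Matrix.isHermitian_conjTranspose_mul_self A).eigenvalues a :=
  (Matrix.posSemidef_conjTranspose_mul_self A).eigenvalues_nonneg a

theorem traceNorm_nonneg (A : Matrix ι ι ℂ) : 0 ≤ traceNorm A :=
  Finset.sum_nonneg fun _ _ => Real.sqrt_nonneg _

theorem star_dotProduct_self (w : ι → ℂ) : star w ⬝ᵥ w = ((∑ a, ‖w a‖ ^ 2 : ℝ) : ℂ) := by
  simp only [dotProduct, Pi.star_apply, RCLike.star_def, RCLike.conj_mul]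
  push_cast
  rfl

/-- The operator norm is at most the trace norm: in an eigenbasis of `Aᴴ A` the left side is a
convex combination of eigenvalues, and each singular value is at most their sum. -/
theorem sum_norm_mulVec_sq_le (A : Matrix ι ι ℂ) {w : ι → ℂ} (hw : IsState w) :
    ∑ a, ‖A.mulVec w a‖ ^ 2 ≤ traceNorm A ^ 2 := by
  set hH := Matrix.isHermitian_conjTranspose_mul_self A with hHdef
  set U := hH.eigenvectorUnitary with hU
  set c : ι → ℂ := (star (U : Matrix ι ι ℂ)).mulVec w with hc
  have hcs : IsState c := isState_mulVec (star U) hw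
  have h1 : star (A.mulVec w) ⬝ᵥ A.mulVec w = star w ⬝ᵥ (A.conjTranspose * A).mulVec w := by
    rw [Matrix.star_mulVec, Matrix.dotProduct_mulVec, Matrix.vecMul_vecMul,
      Matrix.dotProduct_mulVec]
  have h2 : star w ⬝ᵥ (A.conjTranspose * A).mulVec w =
      ((∑ a, hH.eigenvalues a * ‖c a‖ ^ 2 : ℝ) : ℂ) := by
    have hs := hH.spectral_theorem
    rw [Unitary.conjStarAlgAut_apply] at hs
    refine (congrArg (fun B => star w ⬝ᵥ B.mulVec w) hs).trans ?_
    rw [← Matrix.mulVec_mulVec, ← Matrix.mulVec_mulVec, Matrix.dotProduct_mulVec]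
    have h3 : Matrix.vecMul (star w) (U : Matrix ι ι ℂ) = star c := by
      rw [hc, Matrix.star_mulVec, Matrix.star_eq_conjTranspose, Matrix.conjTranspose_conjTranspose]
    rw [← hU, h3, ← hc]
    simp only [dotProduct, Matrix.mulVec_diagonal, Function.comp, Pi.star_apply, Complex.ofReal_sum]
    refine Finset.sum_congr rfl fun a _ => ?_
    rw [mul_left_comm, RCLike.star_def, RCLike.conj_mul]
    push_cast
    rfl
  rw [star_dotProduct_self, h2] at h1
  have h3 := Complex.ofReal_injective h1
  rw [h3]
  have hle : ∀ a, hH.eigenvalues a ≤ traceNorm A ^ 2 := by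
    intro a
    have h4 : Real.sqrt (hH.eigenvalues a) ≤ traceNorm A :=
      Finset.single_le_sum (f := fun a => Real.sqrt (hH.eigenvalues a))
        (fun _ _ => Real.sqrt_nonneg _) (Finset.mem_univ a)
    calc hH.eigenvalues a = Real.sqrt (hH.eigenvalues a) ^ 2 :=
          (Real.sq_sqrt (conjTranspose_mul_self_eigenvalues_nonneg A a)).symm
      _ ≤ traceNorm A ^ 2 := pow_le_pow_left₀ (Real.sqrt_nonneg _) h4 2
  calc ∑ a, hH.eigenvalues a * ‖c a‖ ^ 2 ≤ ∑ a, traceNorm A ^ 2 * ‖c a‖ ^ 2 :=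
        Finset.sum_le_sum fun a _ => mul_le_mul_of_nonneg_right (hle a) (by positivity)
    _ = traceNorm A ^ 2 := by
        rw [← Finset.mul_sum, show ∑ a, ‖c a‖ ^ 2 = 1 from hcs, mul_one]

theorem norm_star_dotProduct_sq_le (v w : ι → ℂ) :
    ‖star v ⬝ᵥ w‖ ^ 2 ≤ (∑ a, ‖v a‖ ^ 2) * ∑ a, ‖w a‖ ^ 2 := by
  have h : ‖star v ⬝ᵥ w‖ ≤ ∑ a, ‖v a‖ * ‖w a‖ := by
    refine (norm_sum_le _ _).trans_eq ?_
    simp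
  exact (pow_le_pow_left₀ (norm_nonneg _) h 2).trans (Finset.sum_mul_sq_le_sq_mul_sq _ _ _)

theorem norm_quadraticForm_le_traceNorm (A : Matrix ι ι ℂ) {w : ι → ℂ} (hw : IsState w) :
    ‖star w ⬝ᵥ A.mulVec w‖ ≤ traceNorm A := by
  refine le_of_sq_le_sq ?_ (traceNorm_nonneg A)
  refine (norm_star_dotProduct_sq_le _ _).trans ?_
  rw [show ∑ a, ‖w a‖ ^ 2 = 1 from hw, one_mul]
  exact sum_norm_mulVec_sq_le A hw

/-- The trace distance of two pure states controls their overlap. -/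
theorem one_sub_sq_le_overlap {u v : ι → ℂ} (hu : IsState u) (hv : IsState v) {δ : ℝ}
    (h : 1 / 2 * traceNorm (ketbra u - ketbra v) ≤ δ) :
    1 - δ ^ 2 ≤ ‖star v ⬝ᵥ u‖ ^ 2 := by
  set c : ℝ := 1 - ‖star v ⬝ᵥ u‖ ^ 2 with hc
  rcases le_or_gt c 0 with hc0 | hc0
  -- Here the squared overlap is already at least one; afterwards `c > 0` allows division by `√c`.
  · nlinarith [sq_nonneg δ]
  set A := ketbra u - ketbra v with hA
  have hherm : A.conjTranspose = A := by
    simp [hA, ketbra, Matrix.conjTranspose_sub, Matrix.conjTranspose_vecMulVec]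
  set hH := Matrix.isHermitian_conjTranspose_mul_self A with hHdef
  have huu := (isState_iff u).1 hu
  have hvv := (isState_iff v).1 hv
  have hmul : ∀ x y : ι → ℂ, ketbra x * ketbra y =
      (star x ⬝ᵥ y) • Matrix.vecMulVec x (star y) := by
    intro x y
    rw [ketbra, ketbra, Matrix.vecMulVec_mul_vecMulVec]
    ext a b
    simp [Matrix.vecMulVec_apply]
    ring
  have htr : ∀ x y : ι → ℂ, (Matrix.vecMulVec x (star y)).trace = star y ⬝ᵥ x := by
    intro x y
    rw [Matrix.trace_vecMulVec, dotProduct_comm]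
  have hov := star_dotProduct_mul_self u v
  have hA2 : A * A = ketbra u + ketbra v - (star u ⬝ᵥ v) • Matrix.vecMulVec u (star v) -
      (star v ⬝ᵥ u) • Matrix.vecMulVec v (star u) := by
    rw [hA, sub_mul, mul_sub, mul_sub, hmul, hmul, hmul, hmul, huu, hvv, one_smul, one_smul]
    change ketbra u - _ - (_ - ketbra v) = _
    abel
  have hA2u : (A * A).mulVec u = (c : ℂ) • u := by
    rw [hA2]
    simp only [Matrix.sub_mulVec, Matrix.add_mulVec, Matrix.smul_mulVec, ketbra_mulVec,
      Matrix.vecMulVec_mulVec, huu]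
    ext a
    simp only [Complex.ofReal_pow] at hov
    simp [hc]
    linear_combination (-u a) * hov
  have hA2v : (A * A).mulVec v = (c : ℂ) • v := by
    rw [hA2]
    simp only [Matrix.sub_mulVec, Matrix.add_mulVec, Matrix.smul_mulVec, ketbra_mulVec,
      Matrix.vecMulVec_mulVec, hvv]
    ext a
    simp only [Complex.ofReal_pow] at hov
    simp [hc]
    linear_combination (-v a) * hov
  -- Both kets out of which `A` is built are eigenvectors of `A * A` for `c`. Hence every nonzero
  -- eigenvalue of `Aᴴ A` equals `c`, and with trace `2 * c` the trace norm is `2 √c`.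
  have hA3 : A * A * A = (c : ℂ) • A := by
    conv_lhs => rw [show A = ketbra u - ketbra v from hA]
    rw [← hA, mul_sub, ketbra, ketbra, Matrix.mul_vecMulVec, Matrix.mul_vecMulVec, hA2u, hA2v,
      Matrix.smul_vecMulVec, Matrix.smul_vecMulVec, ← smul_sub]
    rfl
  have hAA : A.conjTranspose * A = A * A := by rw [hherm]
  have hH2 : (A.conjTranspose * A) * (A.conjTranspose * A) = (c : ℂ) • (A.conjTranspose * A) := by
    rw [hAA, ← mul_assoc, hA3, smul_mul_assoc]
  have hev : ∀ a, hH.eigenvalues a * hH.eigenvalues a = c * hH.eigenvalues a := by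
    intro a
    have he := hH.mulVec_eigenvectorBasis a
    set e : ι → ℂ := (hH.eigenvectorBasis a).ofLp with hedef
    have he0 : e ≠ 0 := by
      intro h0
      apply hH.eigenvectorBasis.orthonormal.ne_zero a
      ext b
      exact congrFun h0 b
    have h2 := congrArg (fun B => Matrix.mulVec B e) hH2
    simp only [← Matrix.mulVec_mulVec, Matrix.smul_mulVec, he, Matrix.mulVec_smul] at h2
    obtain ⟨b, hb⟩ := Function.ne_iff.1 he0
    have h3 := congrFun h2 b
    simp only [Pi.smul_apply, Complex.real_smul, smul_eq_mul, ← mul_assoc] at h3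
    have h4 := mul_right_cancel₀ hb h3
    exact_mod_cast h4
  have hsqrt : ∀ a, Real.sqrt c * Real.sqrt (hH.eigenvalues a) = hH.eigenvalues a := by
    intro a
    rw [← Real.sqrt_mul hc0.le, ← hev a,
      Real.sqrt_mul_self (conjTranspose_mul_self_eigenvalues_nonneg A a)]
  have htrace : ∑ a, hH.eigenvalues a = 2 * c := by
    have h1 := hH.trace_eq_sum_eigenvalues
    have h0 := congrArg Matrix.trace (hAA.trans hA2)
    simp only [Matrix.trace_sub, Matrix.trace_add, Matrix.trace_smul, ketbra, htr, huu, hvv,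
      smul_eq_mul] at h0
    apply Complex.ofReal_injective
    push_cast
    refine (Eq.symm h1).trans (h0.trans ?_)
    rw [hc]
    push_cast
    push_cast at hov
    linear_combination (-2) * hov
  have hmain : Real.sqrt c * traceNorm A = 2 * c := by
    rw [← htrace, traceNorm, Finset.mul_sum]
    exact Finset.sum_congr rfl fun a _ => hsqrt a
  have hs0 : 0 < Real.sqrt c := Real.sqrt_pos.2 hc0
  have hss : Real.sqrt c * Real.sqrt c = c := Real.mul_self_sqrt hc0.le
  have htn : traceNorm A = 2 * Real.sqrt c := by
    apply mul_left_cancel₀ hs0.ne'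
    rw [hmain]
    linarith
  rw [htn] at h
  have : c ≤ δ ^ 2 := by
    rw [← hss, ← sq]
    exact pow_le_pow_left₀ hs0.le (by linarith) 2
  linarith

/-! ### Tensor powers of states -/

/-- The `k`-fold tensor power `|v⟩^{⊗ k}`. -/
def tensorVec (k : ℕ) (v : ι → ℂ) : (Fin k → ι) → ℂ := fun s => ∏ l, v (s l)

theorem isState_tensorVec (k : ℕ) {v : ι → ℂ} (hv : IsState v) : IsState (tensorVec k v) := by
  have h : ∑ s : Fin k → ι, ‖tensorVec k v s‖ ^ 2 = (∑ a, ‖v a‖ ^ 2) ^ k := by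
    rw [Fintype.sum_pow]
    simp only [tensorVec, norm_prod, Finset.prod_pow]
  rw [IsState, h, show ∑ a, ‖v a‖ ^ 2 = 1 from hv, one_pow]

theorem star_tensorVec_dotProduct (k : ℕ) (v w : ι → ℂ) :
    star (tensorVec k v) ⬝ᵥ tensorVec k w = (star v ⬝ᵥ w) ^ k := by
  simp only [dotProduct, Fintype.sum_pow, tensorVec, Pi.star_apply, star_prod,
    Finset.prod_mul_distrib]

theorem tensorPow_mulVec (k : ℕ) (A : Matrix ι ι ℂ) (v : ι → ℂ) :
    (tensorPow k A).mulVec (tensorVec k v) = tensorVec k (A.mulVec v) := by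
  ext s
  simp only [Matrix.mulVec, dotProduct, tensorPow, Matrix.of_apply, tensorVec,
    Finset.prod_univ_sum, Fintype.piFinset_univ, Finset.prod_mul_distrib]

theorem quadraticForm_conjPow (k : ℕ) (A : Matrix ι ι ℂ) (x v : ι → ℂ) :
    star (tensorVec k v) ⬝ᵥ (conjPow k A (ketbra (tensorVec k x))).mulVec (tensorVec k v) =
      ((‖star v ⬝ᵥ A.mulVec x‖ ^ (2 * k) : ℝ) : ℂ) := by
  have h : conjPow k A (ketbra (tensorVec k x)) = ketbra (tensorVec k (A.mulVec x)) := by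
    rw [← tensorPow_mulVec, ← mul_ketbra_mul_conjTranspose]
    rfl
  rw [h, star_dotProduct_ketbra_mulVec, star_tensorVec_dotProduct, norm_pow, ← pow_mul,
    mul_comm k 2]

theorem quadraticForm_haarTwirl (k : ℕ) (x v : ι → ℂ) :
    star (tensorVec k v) ⬝ᵥ (haarTwirl ι k (ketbra (tensorVec k x))).mulVec (tensorVec k v) =
      (haarMoment k x v : ℂ) := by
  set w := tensorVec k v with hw
  set X := ketbra (tensorVec k x) with hX
  have h : (haarMoment k x v : ℂ) = ∫ U : Matrix.unitaryGroup ι ℂ,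
      star w ⬝ᵥ (conjPow k (U : Matrix ι ι ℂ) X).mulVec w ∂(haarUnitary ι) := by
    rw [haarMoment, ← integral_complex_ofReal]
    exact integral_congr_ae (Filter.Eventually.of_forall fun U =>
      (quadraticForm_conjPow k _ x v).symm)
  rw [h]
  have hint : ∀ s t : Fin k → ι, Integrable (fun U : Matrix.unitaryGroup ι ℂ =>
      star w s * (conjPow k (U : Matrix ι ι ℂ) X s t * w t)) (haarUnitary ι) := fun s t =>
    ((integrable_conjPow k X s t).mul_const _).const_mul _
  simp only [dotProduct, Matrix.mulVec, Finset.mul_sum]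
  rw [integral_finsetSum _ fun s _ => integrable_finsetSum _ fun t _ => hint s t]
  refine Finset.sum_congr rfl fun s _ => ?_
  rw [integral_finsetSum _ fun t _ => hint s t]
  refine Finset.sum_congr rfl fun t _ => ?_
  rw [integral_const_mul, integral_mul_const]
  rfl

theorem quadraticForm_twirl (E : UnitaryEnsemble ι) (k : ℕ) (x v : ι → ℂ) :
    star (tensorVec k v) ⬝ᵥ (E.twirl k (ketbra (tensorVec k x))).mulVec (tensorVec k v) =
      ((∑ i, E.p i * ‖star v ⬝ᵥ (E.U i : Matrix ι ι ℂ).mulVec x‖ ^ (2 * k) : ℝ) : ℂ) := by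
  rw [UnitaryEnsemble.twirl, LinearMap.sum_apply, Matrix.sum_mulVec, dotProduct_sum,
    Complex.ofReal_sum]
  refine Finset.sum_congr rfl fun i _ => ?_
  rw [LinearMap.smul_apply, Matrix.smul_mulVec, dotProduct_smul, quadraticForm_conjPow,
    Complex.ofReal_mul, smul_eq_mul]

/-- Expectation values of `Φ(|v⟩⟨v|)` are bounded by the diamond norm of `Φ`. -/
theorem norm_quadraticForm_le_of_diamondNorm_le {κ : Type} [Fintype κ] [DecidableEq κ]
    (Φ : Matrix κ κ ℂ →ₗ[ℂ] Matrix κ κ ℂ) {B : ℝ} (hB : 0 ≤ B)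
    (hΦ : diamondNorm Φ ≤ ENNReal.ofReal B) {v w : κ → ℂ} (hv : IsState v) (hw : IsState w) :
    ‖star w ⬝ᵥ (Φ (ketbra v)).mulVec w‖ ≤ B := by
  obtain ⟨a₀⟩ : Nonempty κ := by
    by_contra h
    rw [not_nonempty_iff] at h
    simp [IsState] at hv
  -- Tensoring with a fixed basis state of the memory: on such product states `Φ ⊗ id` has the same
  -- expectation values as `Φ`.
  let ext : (κ → ℂ) → κ × κ → ℂ := fun u b => if b.2 = a₀ then u b.1 else 0
  have hext : ∀ u, IsState u → IsState (ext u) := by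
    intro u hu
    rw [IsState, Fintype.sum_prod_type, ← show ∑ a, ‖u a‖ ^ 2 = 1 from hu]
    refine Finset.sum_congr rfl fun a _ => ?_
    rw [Finset.sum_eq_single a₀] <;> simp +contextual [ext]
  have h1 : ENNReal.ofReal (traceNorm (withMemory Φ (ketbra (ext v)))) ≤ ENNReal.ofReal B :=
    (le_iSup₂ (f := fun (v : κ × κ → ℂ) (_ : IsState v) =>
      ENNReal.ofReal (traceNorm (withMemory Φ (ketbra v)))) (ext v) (hext v hv)).trans hΦ
  have h2 := (ENNReal.ofReal_le_ofReal_iff hB).1 h1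
  refine le_trans (le_of_eq ?_)
    ((norm_quadraticForm_le_traceNorm (withMemory Φ (ketbra (ext v))) (hext w hw)).trans h2)
  congr 1
  have hblock : (Matrix.of fun s t => ketbra (ext v) (s, a₀) (t, a₀)) = ketbra v := by
    ext s t
    simp [ketbra, Matrix.vecMulVec_apply, ext]
  simp only [dotProduct, Matrix.mulVec, Fintype.sum_prod_type]
  symm
  refine Finset.sum_congr rfl fun s _ => ?_
  rw [Finset.sum_eq_single a₀ (fun b _ hb => by simp [ext, hb]) (by simp)]
  congr 1
  · simp [ext]
  refine Finset.sum_congr rfl fun t _ => ?_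
  rw [Finset.sum_eq_single a₀ (fun b _ hb => by simp [ext, hb]) (by simp)]
  simp only [withMemory, Matrix.of_apply, hblock]
  simp [ext]

theorem UnitaryEnsemble.IsApproxDesign.moment_le {E : UnitaryEnsemble ι} {k : ℕ} {ε : ℝ}
    (hE : E.IsApproxDesign k ε) (hε : 0 ≤ ε) {x v : ι → ℂ} (hx : IsState x) (hv : IsState v) :
    ∑ i, E.p i * ‖star v ⬝ᵥ (E.U i : Matrix ι ι ℂ).mulVec x‖ ^ (2 * k) ≤
      (k ! : ℝ) / (Fintype.card ι : ℝ) ^ k * (1 + ε) := by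
  have hne : Nonempty ι := by
    by_contra h
    rw [not_nonempty_iff] at h
    simp [IsState] at hx
  have hd1 : (1 : ℝ) ≤ (Fintype.card ι : ℝ) := by exact_mod_cast Fintype.card_pos
  set d : ℝ := (Fintype.card ι : ℝ) with hd
  have h1 := norm_quadraticForm_le_of_diamondNorm_le _ (by positivity) hE
    (isState_tensorVec k hx) (isState_tensorVec k hv)
  rw [LinearMap.sub_apply, Matrix.sub_mulVec, dotProduct_sub, quadraticForm_twirl,
    quadraticForm_haarTwirl, ← Complex.ofReal_sub, Complex.norm_real] at h1
  have h2 := (le_abs_self _).trans h1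
  have h3 : haarMoment k x v ≤ (k ! : ℝ) / d ^ k := by
    rw [le_div_iff₀ (by positivity), mul_comm]
    exact card_pow_mul_haarMoment_le k hx hv
  -- The design error is weakened using `d ≥ 1`, so that both terms share the prefactor `k!/d^k`.
  have h4 : (k ! : ℝ) / d ^ (2 * k) * ε ≤ (k ! : ℝ) / d ^ k * ε := by
    gcongr
    omega
  linarith

/-! ### Circuits -/

section Circuits

variable {n q : ℕ}

theorem applyGate_mem_unitaryGroup (g : Matrix.unitaryGroup (Fin q × Fin q) ℂ) {i j : Fin n}
    (hij : i ≠ j) :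
    applyGate (g : Matrix (Fin q × Fin q) (Fin q × Fin q) ℂ) i j ∈
      Matrix.unitaryGroup (Fin n → Fin q) ℂ := by
  classical
  rw [Matrix.mem_unitaryGroup_iff]
  ext s t
  rw [Matrix.mul_apply]
  let upd : Fin q × Fin q → (Fin n → Fin q) := fun b =>
    Function.update (Function.update s i b.1) j b.2
  have hupd_i : ∀ b, upd b i = b.1 := fun b => by simp [upd, hij]
  have hupd_j : ∀ b, upd b j = b.2 := fun b => by simp [upd]
  have hupd_l : ∀ b l, l ≠ i → l ≠ j → upd b l = s l := fun b l hi hj => by simp [upd, hi, hj]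
  -- Only the strings that agree with `s` away from `i` and `j` contribute. Parametrizing them by
  -- their two free letters turns the matrix product into the one for `g` itself.
  have hsum : ∀ F : (Fin n → Fin q) → ℂ,
      (∀ u, ¬ (∀ l, l ≠ i → l ≠ j → s l = u l) → F u = 0) →
        ∑ u, F u = ∑ b, F (upd b) := by
    intro F hF
    symm
    refine Finset.sum_of_injOn upd ?_ (fun _ _ => Finset.mem_coe.2 (Finset.mem_univ _)) ?_
      (fun _ _ => rfl)
    · intro b _ b' _ h
      ext1
      · rw [← hupd_i b, h, hupd_i]
      · rw [← hupd_j b, h, hupd_j]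
    · intro u _ hu
      apply hF u
      intro h
      apply hu
      refine ⟨(u i, u j), Finset.mem_coe.2 (Finset.mem_univ _), ?_⟩
      funext l
      by_cases hlj : l = j
      · subst hlj; exact hupd_j _
      by_cases hli : l = i
      · subst hli; exact hupd_i _
      rw [hupd_l _ l hli hlj, h l hli hlj]
  rw [hsum]
  swap
  · intro u hu
    simp [applyGate, hu]
  have hg := Matrix.mem_unitaryGroup_iff.1 g.2
  have hg' := congrFun (congrFun hg (s i, s j)) (t i, t j)
  rw [Matrix.mul_apply] at hg'
  by_cases hst : ∀ l, l ≠ i → l ≠ j → s l = t l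
  · have h1 : ∀ b, applyGate (g : Matrix (Fin q × Fin q) (Fin q × Fin q) ℂ) i j s (upd b) *
        (star (applyGate (g : Matrix (Fin q × Fin q) (Fin q × Fin q) ℂ) i j)) (upd b) t =
        (g : Matrix (Fin q × Fin q) (Fin q × Fin q) ℂ) (s i, s j) b *
          (star (g : Matrix (Fin q × Fin q) (Fin q × Fin q) ℂ)) b (t i, t j) := by
      intro b
      have ha : ∀ l, l ≠ i → l ≠ j → s l = upd b l := fun l hi hj => (hupd_l b l hi hj).symm
      have hb : ∀ l, l ≠ i → l ≠ j → t l = upd b l := fun l hi hj =>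
        (hst l hi hj).symm.trans (ha l hi hj)
      simp only [applyGate, Matrix.star_apply, Matrix.of_apply, if_pos ha, if_pos hb, hupd_i,
        hupd_j]
    simp_rw [h1]
    rw [hg', Matrix.one_apply, Matrix.one_apply]
    refine if_congr ?_ rfl rfl
    constructor
    · intro h
      rw [Prod.mk.injEq] at h
      funext l
      by_cases hlj : l = j
      · subst hlj; exact h.2
      by_cases hli : l = i
      · subst hli; exact h.1
      exact hst l hli hlj
    · rintro rfl
      rfl
  · rw [Matrix.one_apply, if_neg (by rintro rfl; exact hst fun _ _ _ => rfl)]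
    refine Finset.sum_eq_zero fun b _ => ?_
    have hb : ¬ ∀ l, l ≠ i → l ≠ j → t l = upd b l := fun h => hst fun l hi hj =>
      ((h l hi hj).trans (hupd_l b l hi hj)).symm
    simp only [applyGate, Matrix.star_apply, Matrix.of_apply, if_neg hb, star_zero, mul_zero]

theorem IsCircuit.mem_unitaryGroup {G : Finset (Matrix.unitaryGroup (Fin q × Fin q) ℂ)} {m : ℕ}
    {V : Matrix (Fin n → Fin q) (Fin n → Fin q) ℂ} (hV : IsCircuit n G m V) :
    V ∈ Matrix.unitaryGroup (Fin n → Fin q) ℂ := by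
  induction hV with
  | nil => exact one_mem _
  | cons g i j hg hij hV ih =>
    exact mul_mem (applyGate_mem_unitaryGroup g (by rintro rfl; omega)) ih

/-- There are at most `n - 1` pairs of neighboring qudits. -/
theorem card_neighbors_lt (hn : 1 ≤ n) :
    (Finset.univ.filter fun b : Fin n × Fin n => (b.1 : ℕ) + 1 = (b.2 : ℕ)).card + 1 ≤ n := by
  have h : (Finset.univ.filter fun b : Fin n × Fin n => (b.1 : ℕ) + 1 = (b.2 : ℕ)).card ≤
      (Finset.range (n - 1)).card := by
    refine Finset.card_le_card_of_injOn (fun b => (b.1 : ℕ)) ?_ ?_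
    · intro b hb
      have h1 := (Finset.mem_filter.1 (Finset.mem_coe.1 hb)).2
      have h2 := b.2.2
      simp only [Finset.coe_range, Set.mem_Iio]
      omega
    · intro b hb b' hb' h
      have h1 := (Finset.mem_filter.1 (Finset.mem_coe.1 hb)).2
      have h2 := (Finset.mem_filter.1 (Finset.mem_coe.1 hb')).2
      simp only at h
      ext1 <;> apply Fin.ext <;> omega
  rw [Finset.card_range] at h
  omega

/-- A circuit of size at most `r + 1` either has size at most `r` or is one gate times such a
circuit. There are only `n - 1` gate positions, and the spare factor pays for the shorter circuits:
`1 + |G| (n - 1) ≤ n |G|`, as `G` is nonempty. -/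
theorem exists_finset_circuits_subset (hn : 1 ≤ n)
    {G : Finset (Matrix.unitaryGroup (Fin q × Fin q) ℂ)} (hG : G.Nonempty) (r : ℕ) :
    ∃ C : Finset (Matrix (Fin n → Fin q) (Fin n → Fin q) ℂ),
      (C : Set (Matrix (Fin n → Fin q) (Fin n → Fin q) ℂ)) = circuits n G r ∧
        C.card ≤ n ^ r * G.card ^ r := by
  classical
  induction r with
  | zero =>
    refine ⟨{1}, ?_, by simp⟩
    ext V
    simp only [Finset.coe_singleton, Set.mem_singleton_iff, circuits, Set.mem_ofPred_eq]
    constructor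
    · rintro rfl
      exact ⟨0, le_rfl, IsCircuit.nil⟩
    · rintro ⟨m, hm, hV⟩
      obtain rfl : m = 0 := by omega
      cases hV
      rfl
  | succ r ih =>
    obtain ⟨C, hC, hcard⟩ := ih
    set nb := Finset.univ.filter fun b : Fin n × Fin n => (b.1 : ℕ) + 1 = (b.2 : ℕ) with hnb
    have hnbc : nb.card + 1 ≤ n := card_neighbors_lt hn
    let step : (Matrix.unitaryGroup (Fin q × Fin q) ℂ × (Fin n × Fin n)) ×
        Matrix (Fin n → Fin q) (Fin n → Fin q) ℂ → Matrix (Fin n → Fin q) (Fin n → Fin q) ℂ :=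
      fun a => applyGate (a.1.1 : Matrix (Fin q × Fin q) (Fin q × Fin q) ℂ) a.1.2.1 a.1.2.2 * a.2
    refine ⟨C ∪ ((G ×ˢ nb) ×ˢ C).image step, ?_, ?_⟩
    · ext V
      have hmem : ∀ W, W ∈ C ↔ ∃ m ≤ r, IsCircuit n G m W := fun W => by
        rw [← Finset.mem_coe, hC]; rfl
      simp only [Finset.coe_union, Finset.coe_image, Set.mem_union, Finset.mem_coe, Set.mem_image,
        Finset.mem_product, hmem, circuits, Set.mem_ofPred_eq]
      constructor
      · rintro (⟨m, hm, hV⟩ | ⟨⟨⟨g, i, j⟩, W⟩, ⟨⟨hg, hb⟩, m, hm, hW⟩, rfl⟩)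
        · exact ⟨m, by omega, hV⟩
        · exact ⟨m + 1, by omega, IsCircuit.cons g i j hg (Finset.mem_filter.1 hb).2 hW⟩
      · rintro ⟨m, hm, hV⟩
        cases hV with
        | nil => exact Or.inl ⟨0, Nat.zero_le _, IsCircuit.nil⟩
        | @cons m W g i j hg hij hW =>
          exact Or.inr ⟨((g, i, j), W),
            ⟨⟨hg, Finset.mem_filter.2 ⟨Finset.mem_univ _, hij⟩⟩, m, by omega, hW⟩, rfl⟩
    · have hG1 : 1 ≤ G.card := hG.card_pos
      calc (C ∪ ((G ×ˢ nb) ×ˢ C).image step).card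
          ≤ C.card + G.card * nb.card * C.card := by
            refine (Finset.card_union_le _ _).trans (Nat.add_le_add_left ?_ _)
            refine Finset.card_image_le.trans_eq ?_
            rw [Finset.card_product, Finset.card_product]
        _ ≤ (n * G.card) * C.card := by
            have : 1 + G.card * nb.card ≤ n * G.card := by nlinarith
            nlinarith
        _ ≤ (n * G.card) * (n ^ r * G.card ^ r) := Nat.mul_le_mul_left _ hcard
        _ = n ^ (r + 1) * G.card ^ (r + 1) := by ring

theorem isState_zeroKet (hq : 1 ≤ q) : IsState (zeroKet n q) := by
  rw [IsState, Finset.sum_eq_single (fun _ => ⟨0, hq⟩)]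
  · simp [zeroKet]
  · intro s _ hs
    have : ¬ ∀ l, (s l : ℕ) = 0 := fun h => hs (funext fun l => Fin.ext (h l))
    simp [zeroKet, this]
  · simp

end Circuits

/-! ### State ensembles -/

open Classical in
theorem StateEnsemble.sum_prob_mul (S : StateEnsemble ι) (f : Matrix ι ι ℂ → ℝ)
    {T : Finset (Matrix ι ι ℂ)} (hT : ∀ i, ketbra (S.ψ i) ∈ T) :
    ∑ ρ ∈ T, S.prob ρ * f ρ = ∑ i, S.p i * f (ketbra (S.ψ i)) := by
  simp only [StateEnsemble.prob, Finset.sum_mul]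
  rw [Finset.sum_comm]
  refine Finset.sum_congr rfl fun i _ => ?_
  rw [Finset.sum_eq_single (ketbra (S.ψ i))]
  · simp
  · intro ρ _ hρ
    rw [if_neg hρ.symm, zero_mul]
  · exact fun h => absurd (hT i) h

/-- Averages of functions of the projector depend only on the merged weights, so it does not matter
whether coinciding states are listed separately. The proof sums over a finite set of projectors
containing both supports. -/
theorem StateEnsemble.sum_congr_of_prob_eq {S S' : StateEnsemble ι}
    (h : ∀ ρ, S.prob ρ = S'.prob ρ) (f : Matrix ι ι ℂ → ℝ) :
    ∑ i, S.p i * f (ketbra (S.ψ i)) = ∑ i, S'.p i * f (ketbra (S'.ψ i)) := by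
  classical
  let T := (Finset.univ.image fun i => ketbra (S.ψ i)) ∪
    Finset.univ.image fun i => ketbra (S'.ψ i)
  rw [← S.sum_prob_mul f (T := T) fun i => Finset.mem_union_left _
      (Finset.mem_image_of_mem (fun i => ketbra (S.ψ i)) (Finset.mem_univ i)),
    ← S'.sum_prob_mul f (T := T) fun i => Finset.mem_union_right _
      (Finset.mem_image_of_mem (fun i => ketbra (S'.ψ i)) (Finset.mem_univ i))]
  exact Finset.sum_congr rfl fun ρ _ => by rw [h]

theorem StateEnsemble.IsApproxProjectiveDesign.moment_le {S : StateEnsemble ι} {k : ℕ} {ε : ℝ}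
    (hS : S.IsApproxProjectiveDesign k ε) (hε : 0 ≤ ε) {v : ι → ℂ} (hv : IsState v) :
    ∑ i, S.p i * ‖star v ⬝ᵥ S.ψ i‖ ^ (2 * k) ≤
      (k ! : ℝ) / (Fintype.card ι : ℝ) ^ k * (1 + ε) := by
  obtain ⟨E, x, hx, hE, hprob⟩ := hS
  -- The overlap must be written as a function of the projector alone, hence `⟨v|ρ|v⟩`.
  have h := StateEnsemble.sum_congr_of_prob_eq hprob
    fun ρ => (star v ⬝ᵥ ρ.mulVec v).re ^ k
  simp only [star_dotProduct_ketbra_mulVec, Complex.ofReal_re, ← pow_mul] at h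
  rw [h]
  exact hE.moment_le hε hx hv

/-- The total probability of the members of a projective design that overlap with a fixed state. -/
theorem StateEnsemble.IsApproxProjectiveDesign.sum_overlap_le {S : StateEnsemble ι} {k : ℕ}
    {ε : ℝ} (hS : S.IsApproxProjectiveDesign k ε) (hε : 0 ≤ ε) {v : ι → ℂ} (hv : IsState v)
    {c : ℝ} (hc : 0 ≤ c) {I : Finset (Fin S.N)} (hI : ∀ i ∈ I, c ≤ ‖star v ⬝ᵥ S.ψ i‖ ^ 2) :
    c ^ k * ∑ i ∈ I, S.p i ≤ (k ! : ℝ) / (Fintype.card ι : ℝ) ^ k * (1 + ε) := by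
  refine le_trans ?_ (hS.moment_le hε hv)
  rw [Finset.mul_sum]
  calc ∑ i ∈ I, c ^ k * S.p i ≤ ∑ i ∈ I, S.p i * ‖star v ⬝ᵥ S.ψ i‖ ^ (2 * k) := by
        refine Finset.sum_le_sum fun i hi => ?_
        rw [mul_comm, pow_mul]
        exact mul_le_mul_of_nonneg_left (pow_le_pow_left₀ hc (hI i hi) k) (S.p_nonneg i)
    _ ≤ _ := Finset.sum_le_sum_of_subset_of_nonneg (Finset.subset_univ _)
        fun i _ _ => mul_nonneg (S.p_nonneg i) (by positivity)

theorem norm_star_dotProduct_eq_one_of_ketbra_eq {u v : ι → ℂ} (hv : IsState v)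
    (h : ketbra u = ketbra v) : ‖star v ⬝ᵥ u‖ ^ 2 = 1 := by
  have h1 := star_dotProduct_ketbra_mulVec u v
  rw [h, star_dotProduct_ketbra_mulVec, (isState_iff v).1 hv] at h1
  have h2 := Complex.ofReal_injective h1
  simpa using h2.symm

end DesignComplexity

end

/-! ### Counting the states of high complexity -/

theorem mainTheorem10 (n q k r : ℕ) (hn : 1 ≤ n)
    (G : Finset (Matrix.unitaryGroup (Fin q × Fin q) ℂ)) (hG : G.Nonempty)
    (ε δ : ℝ) (hε : 0 ≤ ε) (hδ0 : 0 ≤ δ) (hδ1 : δ < 1)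
    (S : DesignComplexity.StateEnsemble (Fin n → Fin q))
    (hS : S.IsApproxProjectiveDesign k ε) :
    ((q : ℝ) ^ n) ^ k / (k ! : ℝ) * (1 / (1 + ε)) -
        (n : ℝ) ^ r * (G.card : ℝ) ^ r / (1 - δ ^ 2) ^ k ≤
      (Set.ncard {ρ : Matrix (Fin n → Fin q) (Fin n → Fin q) ℂ |
        ∃ i, 0 < S.p i ∧ ρ = DesignComplexity.ketbra (S.ψ i) ∧
          ¬ DesignComplexity.WeakComplexityLE G δ r (S.ψ i)} : ℝ) := by
  classical
  -- With `q = 0` and `n ≥ 1` the space is zero and contains no starting state for the orbit.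
  have hq : 1 ≤ q := by
    by_contra hq
    obtain rfl : q = 0 := by omega
    obtain ⟨_, x, hx, _⟩ := hS
    have : IsEmpty (Fin n → Fin 0) := ⟨fun s => (s ⟨0, hn⟩).elim0⟩
    simp [DesignComplexity.IsState] at hx
  set d : ℝ := (q : ℝ) ^ n with hd
  have hd0 : 0 < d := by
    have : (0 : ℝ) < q := by exact_mod_cast hq
    positivity
  have hdcard : ((Fintype.card (Fin n → Fin q) : ℕ) : ℝ) = d := by simp [hd]
  set W : ℝ := (k ! : ℝ) / d ^ k * (1 + ε) with hW
  have hW0 : 0 < W := by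
    have : (0 : ℝ) < (k ! : ℝ) := by exact_mod_cast Nat.factorial_pos k
    positivity
  set c : ℝ := 1 - δ ^ 2 with hc
  have hc0 : 0 < c := by nlinarith
  have hWc : ∀ {v : (Fin n → Fin q) → ℂ}, DesignComplexity.IsState v → ∀ {b : ℝ}, 0 ≤ b →
      ∀ {I : Finset (Fin S.N)}, (∀ i ∈ I, b ≤ ‖star v ⬝ᵥ S.ψ i‖ ^ 2) →
        b ^ k * ∑ i ∈ I, S.p i ≤ W := by
    intro v hv b hb I hI
    have := hS.sum_overlap_le hε hv hb hI
    rwa [hdcard] at this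
  obtain ⟨C, hC, hCcard⟩ := DesignComplexity.exists_finset_circuits_subset hn hG r
  set B : Set (Matrix (Fin n → Fin q) (Fin n → Fin q) ℂ) := {ρ |
    ∃ i, 0 < S.p i ∧ ρ = DesignComplexity.ketbra (S.ψ i) ∧
      ¬ DesignComplexity.WeakComplexityLE G δ r (S.ψ i)} with hB
  have hBfin : B.Finite := by
    refine (Set.finite_range fun i => DesignComplexity.ketbra (S.ψ i)).subset ?_
    rintro ρ ⟨i, _, rfl, _⟩
    exact ⟨i, rfl⟩
  have hBcard : B.ncard = hBfin.toFinset.card := Set.ncard_eq_toFinset_card B hBfin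
  set T := hBfin.toFinset with hT
  -- The sum runs over all labels carrying the same projector, since `T` counts distinct pure
  -- states.
  have hhigh : ∀ ρ ∈ T,
      ∑ i ∈ Finset.univ.filter (fun i => DesignComplexity.ketbra (S.ψ i) = ρ), S.p i ≤ W := by
    intro ρ hρ
    obtain ⟨j, _, rfl, _⟩ := (Set.Finite.mem_toFinset hBfin).1 hρ
    have := hWc (S.isState j) (b := 1) zero_le_one (I := Finset.univ.filter
      (fun i => DesignComplexity.ketbra (S.ψ i) = DesignComplexity.ketbra (S.ψ j))) fun i hi =>
        (DesignComplexity.norm_star_dotProduct_eq_one_of_ketbra_eq (S.isState j)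
          (Finset.mem_filter.1 hi).2).ge
    simpa using this
  let close : Matrix (Fin n → Fin q) (Fin n → Fin q) ℂ → Finset (Fin S.N) := fun V =>
    Finset.univ.filter fun i => 1 / 2 * DesignComplexity.traceNorm
      (DesignComplexity.ketbra (S.ψ i) -
        V * DesignComplexity.ketbra (DesignComplexity.zeroKet n q) * V.conjTranspose) ≤ δ
  have hlow : ∀ V ∈ C, ∑ i ∈ close V, S.p i ≤ W / c ^ k := by
    intro V hV
    rw [← Finset.mem_coe, hC] at hV
    obtain ⟨m, _, hV⟩ := hV
    have hst : DesignComplexity.IsState (V.mulVec (DesignComplexity.zeroKet n q)) :=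
      DesignComplexity.isState_mulVec ⟨V, hV.mem_unitaryGroup⟩
        (DesignComplexity.isState_zeroKet hq)
    rw [le_div_iff₀ (by positivity), mul_comm]
    refine hWc hst hc0.le fun i hi => ?_
    have h1 := (Finset.mem_filter.1 hi).2
    rw [DesignComplexity.mul_ketbra_mul_conjTranspose] at h1
    exact DesignComplexity.one_sub_sq_le_overlap (S.isState i) hst h1
  -- A union bound: a member of positive probability either has its projector in `T` or is close to
  -- the output of some circuit in `C`.
  have hcover : ∀ i, S.p i ≤
      (∑ ρ ∈ T, if DesignComplexity.ketbra (S.ψ i) = ρ then S.p i else 0) +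
        ∑ V ∈ C, if i ∈ close V then S.p i else 0 := by
    intro i
    have hn1 : ∀ ρ ∈ T, 0 ≤ if DesignComplexity.ketbra (S.ψ i) = ρ then S.p i else 0 :=
      fun ρ _ => by split_ifs; exacts [S.p_nonneg i, le_rfl]
    have hn2 : ∀ V ∈ C, 0 ≤ if i ∈ close V then S.p i else 0 :=
      fun V _ => by split_ifs; exacts [S.p_nonneg i, le_rfl]
    rcases (S.p_nonneg i).eq_or_lt with h0 | h0
    · rw [← h0]; simp
    by_cases hw : DesignComplexity.WeakComplexityLE G δ r (S.ψ i)
    · obtain ⟨V, hV, hVi⟩ := hw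
      rw [← hC, Finset.mem_coe] at hV
      have h1 := Finset.single_le_sum hn2 hV
      rw [if_pos (Finset.mem_filter.2 ⟨Finset.mem_univ i, hVi⟩)] at h1
      exact h1.trans (le_add_of_nonneg_left (Finset.sum_nonneg hn1))
    · have h1 := Finset.single_le_sum hn1
        ((Set.Finite.mem_toFinset hBfin).2 ⟨i, h0, rfl, hw⟩)
      rw [if_pos rfl] at h1
      exact h1.trans (le_add_of_nonneg_right (Finset.sum_nonneg hn2))
  have htotal : 1 ≤ (T.card : ℝ) * W + (C.card : ℝ) * (W / c ^ k) := by
    calc (1 : ℝ) = ∑ i, S.p i := S.p_sum.symm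
      _ ≤ ∑ i, ((∑ ρ ∈ T, if DesignComplexity.ketbra (S.ψ i) = ρ then S.p i else 0) +
            ∑ V ∈ C, if i ∈ close V then S.p i else 0) := Finset.sum_le_sum fun i _ => hcover i
      _ = (∑ ρ ∈ T, ∑ i ∈ Finset.univ.filter
            (fun i => DesignComplexity.ketbra (S.ψ i) = ρ), S.p i) +
            ∑ V ∈ C, ∑ i ∈ close V, S.p i := by
          rw [Finset.sum_add_distrib, Finset.sum_comm, Finset.sum_comm (t := C)]
          simp only [Finset.sum_filter, Finset.sum_ite_mem, Finset.univ_inter]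
      _ ≤ (T.card : ℝ) * W + (C.card : ℝ) * (W / c ^ k) := by
          rw [← nsmul_eq_mul, ← nsmul_eq_mul]
          exact add_le_add (Finset.sum_le_card_nsmul _ _ _ hhigh)
            (Finset.sum_le_card_nsmul _ _ _ hlow)
  have hCR : (C.card : ℝ) ≤ (n : ℝ) ^ r * (G.card : ℝ) ^ r := by exact_mod_cast hCcard
  have hinv : d ^ k / (k ! : ℝ) * (1 / (1 + ε)) = 1 / W := by
    rw [hW]
    have : (k ! : ℝ) ≠ 0 := by exact_mod_cast (Nat.factorial_pos k).ne'
    have : 1 + ε ≠ 0 := by positivity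
    field_simp
  rw [hBcard, hinv, sub_le_iff_le_add]
  calc 1 / W ≤ ((T.card : ℝ) * W + (C.card : ℝ) * (W / c ^ k)) / W := by gcongr
    _ = (T.card : ℝ) + (C.card : ℝ) / c ^ k := by field_simp
    _ ≤ (T.card : ℝ) + (n : ℝ) ^ r * (G.card : ℝ) ^ r / c ^ k := by gcongr
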